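/- Let $n\ge 0$, $[n]=\{1,\dots,n\}$, and let $G$ be a hypergraph on $[n]$, i.e. a set of subsets $U\subseteq[n]$ (hyperedges) with $|U|\ge 2$. Let $$P_G=\sum_{U\in G}\Delta_U\subset\mathbb R^n$$ be its hypergraphic polytope, the Minkowski sum of the simplices $\Delta_U=\operatorname{conv}\{e_i : i\in U\}$. Definitions. A \emph{flat} of $G$ is a hypergraph of the form $F=\{U\in G : U\subseteq A_i\text{ for some } i\}$, where $(A_1,\dots,A_k)$ is a sequence of nonempty, pairwise disjoint sets with union $[n]$. For a flat $F$, let $[n]/F$ be the finest set partition $\{A_1,\dots,A_k\}$ of $[n]$ defining $F$ in this way (its parts are the connected components of $F$), and let $G/F$ be the hypergraph on the vertex set $[n]/F$ whose hyperedges are the images of the hyperedges $U\in G\setminus F$. An \emph{orientation} $\mathcal O$ of a hypergraph $H$ on a vertex set $V$ assigns to each hyperedge $U$ an ordered partition $(\mathfrak a,\mathfrak b)$ of $U$ into two nonempty sets; $\mathfrak a$ is called the head. Let $V/\mathcal O$ be the set partition of $V$ generated by identifying any two vertices that lie in a common head, and let $H/\mathcal O$ be the directed graph on $V/\mathcal O$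 with an arrow $([a],[b])$ for every oriented hyperedge $(\mathfrak a,\mathfrak b)$ of $\mathcal O$ and all $a\in\mathfrak a$, $b\in\mathfrak b$. The orientation $\mathcal O$ is \emph{acyclic} if $H/\mathcal O$ has no directed cycle (a loop is a cycle). Let $\mathcal{AO}$ be the set of all acyclic orientations of the contractions $G/F$, for $F$ ranging over the flats of $G$. For an orientation $\mathcal O$ of $G/F$, let $[n]/\mathcal O$ be the set partition of $[n]$ induced by $([n]/F)/\mathcal O$, and put $$C_{\mathcal O}=\{\mathbf x\in(\mathbb R^n)^* : x_a=x_b\text{ if } a,b \text{ are identified in } [n]/\mathcal O,\ \ x_a\ge x_b\text{ if } ([a],[b])\text{ is an arrow of }(G/F)/\mathcal O\},$$ where $x_i=\mathbf x(e_i)$. For a nonempty face $f$ of $P_G$ (that is, the nonempty set of maximizers over $P_G$ of some linear functional), its normal cone $N(f)$ is the set of linear functionals $\mathbf x\in(\mathbb R^n)^*$ that attain their maximum over $P_G$ at every point of $f$. The normal fan is $\mathcal N(P_G)=\{N(f) : f\text{ a nonempty face of }P_G\}$. Theorem. The normal fan of $P_G$ consists exactly of the cones $C_{\mathcal O}$: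 $$\mathcal N(P_G)=\{C_{\mathcal O} : \mathcal O\in\mathcal{AO}\}.$$ Moreover, there is a bijection $\varphi$ from $\mathcal{AO}$ onto the set of nonempty faces of $P_G$ such that $N(\varphi(\mathcal O))=C_{\mathcal O}$ for all $\mathcal O\in\mathcal{AO}$. -/

import Mathlib

open scoped Pointwise

/-- A (simple) hypergraph on the vertex set `V`: a finite collection of hyperedges `U ⊆ V`
with `|U| ≥ 2`. -/
@[ext]
structure HGraph (V : Type*) where
  edges : Finset (Finset V)
  two_le_card : ∀ U ∈ edges, 2 ≤ U.card

/-- A set composition `(A_1, …, A_k)` of `V`: a sequence of nonempty, pairwise disjoint sets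
whose union is `V`. -/
structure SetComposition (V : Type*) where
  length : ℕ
  part : Fin length → Finset V
  nonempty : ∀ i, (part i).Nonempty
  pairwiseDisjoint : ∀ i j, i ≠ j → Disjoint (part i) (part j)
  cover : ∀ v, ∃ i, v ∈ part i

/-- An orientation of a hyperedge `U`: an ordered partition `(head, tail)` of `U` into two
nonempty parts. -/
structure EdgeOrientation {V : Type*} (U : Finset V) where
  head : Finset V
  tail : Finset V
  head_nonempty : head.Nonempty
  tail_nonempty : tail.Nonempty
  disjoint : Disjoint head tail
  mem_iff : ∀ v, v ∈ U ↔ v ∈ head ∨ v ∈ tail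

namespace HGraph

variable {V : Type*}

open Classical in
/-- `G|_A = G|_{A_1} ∪ ⋯ ∪ G|_{A_k}`: the hyperedges of `G` contained in some part of `A`. -/
noncomputable def restrict (G : HGraph V) (A : SetComposition V) : HGraph V where
  edges := G.edges.filter (fun U => ∃ i, U ⊆ A.part i)
  two_le_card := fun U hU => G.two_le_card U (Finset.mem_filter.mp hU).1

/-- The flats of `G`: the hypergraphs `G|_A`, for `A` a set composition of `V`. -/
def flats (G : HGraph V) : Set (HGraph V) :=
  {F | ∃ A : SetComposition V, F = G.restrict A}

/-- The set partition `V/F` as an equivalence relation: the one generated by identifying any two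
vertices in a common hyperedge of `F` (the connected components of `F`). For a flat `F` of `G` it
is the finest set partition with `G|_A = F`, see `mem_flat_iff` and `components_finest`. -/
def components (F : HGraph V) : Setoid V :=
  Relation.EqvGen.setoid (fun u v => ∃ U ∈ F.edges, u ∈ U ∧ v ∈ U)

open Classical in
/-- The contraction `G/F`, a hypergraph on `V/F`: its hyperedges are the images of the hyperedges
of `G` under `V → V/F`, those contracted to a single point being discarded. -/
noncomputable def contract (G F : HGraph V) : HGraph (Quotient F.components) where
  edges := (G.edges.image (fun U => U.image (Quotient.mk F.components))).filter
    (fun W => 2 ≤ W.card)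
  two_le_card := fun _ hW => (Finset.mem_filter.mp hW).2

/-- `V/F` refines every set composition `A` with `G|_A = F`. -/
theorem components_finest (G : HGraph V) (A : SetComposition V) (u v : V)
    (h : (G.restrict A).components u v) : ∀ i, u ∈ A.part i ↔ v ∈ A.part i := by
  classical
  have h' : Relation.EqvGen
      (fun u v => ∃ U ∈ (G.restrict A).edges, u ∈ U ∧ v ∈ U) u v := h
  induction h' with
  | rel x y hxy =>
    obtain ⟨U, hU, hx, hy⟩ := hxy
    obtain ⟨j, hj⟩ := (Finset.mem_filter.mp hU).2
    intro i
    by_cases hij : i = j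
    · subst hij
      exact ⟨fun _ => hj hy, fun _ => hj hx⟩
    · have hd := Finset.disjoint_left.mp (A.pairwiseDisjoint i j hij)
      exact ⟨fun hi => (hd hi (hj hx)).elim, fun hi => (hd hi (hj hy)).elim⟩
  | refl x => exact fun _ => Iff.rfl
  | symm x y hxy ih => exact fun i => (ih hxy i).symm
  | trans x y z hxy hyz ih1 ih2 => exact fun i => (ih1 hxy i).trans (ih2 hyz i)

/-- For a flat `F` of `G`, the hyperedges of `F` are exactly the hyperedges of `G` contained in a
single part of `V/F`, that is, those contracted to a point in `G/F`. -/
theorem mem_flat_iff (G F : HGraph V) (hF : F ∈ G.flats) (U : Finset V) (hU : U ∈ G.edges) :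
    U ∈ F.edges ↔ ∀ u ∈ U, ∀ v ∈ U, F.components u v := by
  classical
  obtain ⟨A, rfl⟩ := hF
  refine ⟨fun h u hu v hv => Relation.EqvGen.rel _ _ ⟨U, h, hu, hv⟩, fun h => ?_⟩
  have hne : U.Nonempty := Finset.card_pos.mp (by have := G.two_le_card U hU; omega)
  obtain ⟨u, hu⟩ := hne
  obtain ⟨i, hi⟩ := A.cover u
  exact Finset.mem_filter.mpr
    ⟨hU, i, fun v hv => (components_finest G A u v (h u hu v hv) i).mp hi⟩

/-- An orientation of `G`: an orientation of each of its hyperedges. -/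
def Orientation (G : HGraph V) : Type _ :=
  (U : {U : Finset V // U ∈ G.edges}) → EdgeOrientation U.1

namespace Orientation

variable {G : HGraph V}

/-- The set partition `V/O`, as an equivalence relation: generated by identifying any two vertices
in a common head of `O`. -/
def identified (O : G.Orientation) : Setoid V :=
  Relation.EqvGen.setoid (fun a a' => ∃ U, a ∈ (O U).head ∧ a' ∈ (O U).head)

/-- The arrows of the oriented graph `G/O` on `V/O`: `[a] → [b]` whenever `a` lies in the head and
`b` in the tail of the same oriented hyperedge. -/
def Arrow (O : G.Orientation) (p q : Quotient O.identified) : Prop :=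
  ∃ U, ∃ a ∈ (O U).head, ∃ b ∈ (O U).tail,
    p = Quotient.mk O.identified a ∧ q = Quotient.mk O.identified b

/-- `O` is acyclic: `G/O` has no directed cycle (loops count as cycles). -/
def IsAcyclic (O : G.Orientation) : Prop :=
  ∀ p, ¬ Relation.TransGen O.Arrow p p

end Orientation

/-- The set `AO` of all acyclic orientations of the contractions `G/F`, for `F` a flat of `G`. -/
def AcyclicOrientations (G : HGraph V) : Type _ :=
  Σ F : {F : HGraph V // F ∈ G.flats}, {O : (G.contract F.1).Orientation // O.IsAcyclic}

/-- The class of `v` in `V/O`, for `O` an orientation of `G/F`: its image under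
`V → V/F → (V/F)/O`. -/
noncomputable def vertexClass {G F : HGraph V} (O : (G.contract F).Orientation) (v : V) :
    Quotient O.identified :=
  Quotient.mk O.identified (Quotient.mk F.components v)

/-- The cone `C_O` in the dual of `ℝⁿ`; the coordinates of a functional `x` are
`x_i = x (e_i)`. -/
def orientationCone {n : ℕ} {G F : HGraph (Fin n)} (O : (G.contract F).Orientation) :
    Set (StrongDual ℝ (Fin n → ℝ)) :=
  {x | (∀ a b, vertexClass O a = vertexClass O b → x (Pi.single a 1) = x (Pi.single b 1)) ∧
    (∀ a b, O.Arrow (vertexClass O a) (vertexClass O b) →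
      x (Pi.single a 1) ≥ x (Pi.single b 1))}

/-- The hypergraphic polytope `P_G = ∑_{U ∈ G} Δ_U` (Minkowski sum), where `Δ_U` is the convex
hull of the `e_i`, `i ∈ U`. -/
noncomputable def polytope {n : ℕ} (G : HGraph (Fin n)) : Set (Fin n → ℝ) :=
  ∑ U ∈ G.edges, convexHull ℝ ((fun i : Fin n => (Pi.single i 1 : Fin n → ℝ)) '' (U : Set (Fin n)))

end HGraph

/-- The nonempty faces of `P`: the nonempty sets of maximizers over `P` of linear functionals. -/
def polytopeFaces {n : ℕ} (P : Set (Fin n → ℝ)) : Set (Set (Fin n → ℝ)) :=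
  {f | f.Nonempty ∧ IsExposed ℝ P f}

/-- The normal cone of a face `f` of `P`: the functionals whose set of maximizers over `P`
contains `f`. -/
def normalCone {n : ℕ} (P f : Set (Fin n → ℝ)) : Set (StrongDual ℝ (Fin n → ℝ)) :=
  {c | f ⊆ {x ∈ P | ∀ y ∈ P, c y ≤ c x}}

/-- The normal fan of `P`: the collection of the normal cones of its nonempty faces. -/
def normalFan {n : ℕ} (P : Set (Fin n → ℝ)) : Set (Set (StrongDual ℝ (Fin n → ℝ))) :=
  {C | ∃ f ∈ polytopeFaces P, C = normalCone P f}

/-! Everything is encoded by families of nonempty subsets of the hyperedges. A functional `x` gives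
the family `argmaxOn x U`. An orientation of `G/F` gives `leading O U`: all of `U` if `U ∈ F`,
otherwise the part of `U` lying over the head of its image.

On the polytope side, a point of a Minkowski sum maximizes `x` exactly when each summand does, so
inclusion of maximal faces is inclusion of argmax sets, hyperedge by hyperedge
(`maxFace_subset_iff`). On the combinatorial side, `C_O` consists of the `y` whose argmax sets
contain the leading sets (`weak_iff_leading_subset`).

The two sides meet in strict functions, for which the argmax sets equal the leading sets. Every
acyclic orientation has one (`exists_isStrict`), and every function is strict for some acyclic
orientation (`exists_acyclicOrientation_isStrict`). Sending `O` to the face of a strict functional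
therefore gives normal cone `C_O` and is surjective; it is injective because leading sets determine
the flat and the orientation (`AcyclicOrientations.eq_of_leading_eq`). -/

namespace HGraph

/-! ### Leading sets of an orientation -/

section Combinatorics

variable {V : Type*} {G F : HGraph V}

theorem eq_of_eqvGen {α β : Type*} {r : α → α → Prop} (f : α → β)
    (h : ∀ a b, r a b → f a = f b) {a b : α} (hab : Relation.EqvGen r a b) : f a = f b := by
  induction hab with
  | rel a b hab => exact h a b hab
  | refl => rfl
  | symm _ _ _ ih => exact ih.symm
  | trans _ _ _ _ _ ih1 ih2 => exact ih1.trans ih2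

/-- The elements of `U` at which `x` is maximal over `U`. -/
def argmaxOn (x : V → ℝ) (U : Finset V) : Set V :=
  {i | i ∈ U ∧ ∀ j ∈ U, x j ≤ x i}

theorem argmaxOn_nonempty (x : V → ℝ) {U : Finset V} (hU : U.Nonempty) :
    (argmaxOn x U).Nonempty := by
  obtain ⟨i, hi, h⟩ := U.exists_max_image x hU
  exact ⟨i, hi, h⟩

theorem nonempty_of_mem_edges {U : Finset V} (hU : U ∈ G.edges) : U.Nonempty :=
  Finset.card_pos.mp (by have := G.two_le_card U hU; omega)

theorem edges_subset_of_mem_flats (hF : F ∈ G.flats) : F.edges ⊆ G.edges := by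
  classical
  obtain ⟨A, rfl⟩ := hF
  exact fun U hU => (Finset.mem_filter.mp hU).1

open Classical in
/-- The image of a hyperedge of `G` under `V → V/F`. -/
noncomputable def edgeImage (F : HGraph V) (U : Finset V) : Finset (Quotient F.components) :=
  U.image (Quotient.mk F.components)

theorem mem_edgeImage {U : Finset V} {q : Quotient F.components} :
    q ∈ F.edgeImage U ↔ ∃ u ∈ U, Quotient.mk F.components u = q := by
  classical
  simp [edgeImage]

theorem mem_contract_edges {W : Finset (Quotient F.components)} :
    W ∈ (G.contract F).edges ↔ (∃ U ∈ G.edges, F.edgeImage U = W) ∧ 2 ≤ W.card := by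
  classical
  simp [contract, edgeImage]

/-- The hyperedges of `G` that survive in `G/F` are those outside the flat `F`. -/
theorem edgeImage_mem_contract_iff (hF : F ∈ G.flats) {U : Finset V} (hU : U ∈ G.edges) :
    F.edgeImage U ∈ (G.contract F).edges ↔ U ∉ F.edges := by
  classical
  rw [mem_contract_edges, mem_flat_iff G F hF U hU]
  constructor
  · rintro ⟨-, h⟩ hc
    obtain ⟨p, hp, q, hq, hpq⟩ := Finset.one_lt_card.mp h
    obtain ⟨u, hu, rfl⟩ := mem_edgeImage.mp hp
    obtain ⟨v, hv, rfl⟩ := mem_edgeImage.mp hq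
    exact hpq (Quotient.sound (hc u hu v hv))
  · intro h
    push Not at h
    obtain ⟨u, hu, v, hv, huv⟩ := h
    refine ⟨⟨U, hU, rfl⟩, Finset.one_lt_card.mpr
      ⟨_, mem_edgeImage.mpr ⟨u, hu, rfl⟩, _, mem_edgeImage.mpr ⟨v, hv, rfl⟩, fun h => ?_⟩⟩
    exact huv (Quotient.exact h)

/-- The elements of a hyperedge `U` of `G` that an orientation of `G/F` makes maximal: the
preimage of the head, or all of `U` if `U` is contracted to a point. -/
def leading (O : (G.contract F).Orientation) (U : Finset V) : Set V :=
  {i | i ∈ U ∧ ∀ h : F.edgeImage U ∈ (G.contract F).edges,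
    Quotient.mk F.components i ∈ (O ⟨F.edgeImage U, h⟩).head}

theorem leading_of_mem (hF : F ∈ G.flats) (O : (G.contract F).Orientation) {U : Finset V}
    (hU : U ∈ F.edges) : leading O U = U := by
  ext i
  refine ⟨fun h => h.1, fun h => ⟨h, fun hc => ?_⟩⟩
  exact ((edgeImage_mem_contract_iff hF (edges_subset_of_mem_flats hF hU)).mp hc hU).elim

/-- Tails are nonempty, so a hyperedge that survives in `G/F` has a member that does not lead.
Together with `leading_of_mem`, this recovers `F` from the leading sets. -/
theorem mem_edges_of_leading_eq (hF : F ∈ G.flats) (O : (G.contract F).Orientation)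
    {U : Finset V} (hU : U ∈ G.edges) (h : leading O U = U) : U ∈ F.edges := by
  by_contra hc
  have hW := (edgeImage_mem_contract_iff hF hU).mpr hc
  obtain ⟨q, hq⟩ := (O ⟨_, hW⟩).tail_nonempty
  obtain ⟨u, hu, rfl⟩ := mem_edgeImage.mp (((O ⟨_, hW⟩).mem_iff q).mpr (Or.inr hq))
  have hl : u ∈ leading O U := h ▸ hu
  exact Finset.disjoint_left.mp (O ⟨_, hW⟩).disjoint (hl.2 hW) hq

/-- Several hyperedges of `G` may have the same image in `G/F`; the leading set of any one of them
recovers the head. -/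
theorem mem_head_iff (O : (G.contract F).Orientation) {U : Finset V}
    (h : F.edgeImage U ∈ (G.contract F).edges) (q : Quotient F.components) :
    q ∈ (O ⟨F.edgeImage U, h⟩).head ↔ ∃ i ∈ leading O U, Quotient.mk F.components i = q := by
  constructor
  · intro hq
    obtain ⟨i, hi, rfl⟩ := mem_edgeImage.mp (((O ⟨_, h⟩).mem_iff q).mpr (Or.inl hq))
    exact ⟨i, ⟨hi, fun _ => hq⟩, rfl⟩
  · rintro ⟨i, hi, rfl⟩
    exact hi.2 h

end Combinatorics

end HGraph

theorem EdgeOrientation.eq_of_head_eq {V : Type*} {U : Finset V} {o o' : EdgeOrientation U}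
    (h : o.head = o'.head) : o = o' := by
  have ht : o.tail = o'.tail := by
    ext v
    have h1 := o.mem_iff v
    have h2 := o'.mem_iff v
    have h3 : v ∈ o.head → v ∉ o.tail := fun hv => Finset.disjoint_left.mp o.disjoint hv
    have h4 : v ∈ o'.head → v ∉ o'.tail := fun hv => Finset.disjoint_left.mp o'.disjoint hv
    rw [h] at h1 h3
    tauto
  cases o
  cases o'
  cases h
  cases ht
  rfl

namespace HGraph

section Combinatorics

variable {V : Type*} {G F : HGraph V}

/-- An acyclic orientation of a contraction is determined by its leading sets. -/
theorem AcyclicOrientations.eq_of_leading_eq (o o' : G.AcyclicOrientations)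
    (h : ∀ U ∈ G.edges, leading o.2.1 U = leading o'.2.1 U) : o = o' := by
  obtain ⟨⟨F, hF⟩, O, hO⟩ := o
  obtain ⟨⟨F', hF'⟩, O', hO'⟩ := o'
  dsimp only at h
  have hFF : F = F' := by
    ext U
    constructor
    · intro hU
      have hG := edges_subset_of_mem_flats hF hU
      exact mem_edges_of_leading_eq hF' O' hG ((h U hG).symm.trans (leading_of_mem hF O hU))
    · intro hU
      have hG := edges_subset_of_mem_flats hF' hU
      exact mem_edges_of_leading_eq hF O hG ((h U hG).trans (leading_of_mem hF' O' hU))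
  subst hFF
  have hOO : O = O' := by
    funext ⟨W, hW⟩
    obtain ⟨⟨U, hU, rfl⟩, -⟩ := mem_contract_edges.mp hW
    apply EdgeOrientation.eq_of_head_eq
    ext q
    rw [mem_head_iff, mem_head_iff, h U hU]
  subst hOO
  rfl

/-! ### Strict functions and the cone of an orientation -/

/-- `x` is constant on the classes of `O` and strictly decreases along its arrows. -/
def IsStrict (O : (G.contract F).Orientation) (x : V → ℝ) : Prop :=
  (∀ a b, vertexClass O a = vertexClass O b → x a = x b) ∧
    ∀ a b, O.Arrow (vertexClass O a) (vertexClass O b) → x b < x a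

theorem IsStrict.argmaxOn_eq {O : (G.contract F).Orientation} {x : V → ℝ} (hx : IsStrict O x)
    (hF : F ∈ G.flats) {U : Finset V} (hU : U ∈ G.edges) : argmaxOn x U = leading O U := by
  -- On a surviving hyperedge, all members over the head share one value and those over the tail lie
  -- strictly below it.
  have key : ∀ h : F.edgeImage U ∈ (G.contract F).edges, ∀ i ∈ U, ∀ j ∈ U,
      Quotient.mk F.components i ∈ (O ⟨_, h⟩).head →
      (Quotient.mk F.components j ∈ (O ⟨_, h⟩).head ∧ x j = x i) ∨
      (Quotient.mk F.components j ∈ (O ⟨_, h⟩).tail ∧ x j < x i) := by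
    intro h i _ j hj hi
    rcases ((O ⟨_, h⟩).mem_iff _).mp (mem_edgeImage.mpr ⟨j, hj, rfl⟩) with hj' | hj'
    · exact Or.inl ⟨hj', hx.1 _ _ (Quotient.sound (Relation.EqvGen.rel _ _ ⟨_, hj', hi⟩))⟩
    · exact Or.inr ⟨hj', hx.2 _ _ ⟨_, _, hi, _, hj', rfl, rfl⟩⟩
  ext i
  constructor
  · rintro ⟨hi, hmax⟩
    refine ⟨hi, fun h => ?_⟩
    obtain ⟨q, hq⟩ := (O ⟨_, h⟩).head_nonempty
    obtain ⟨j, hj, rfl⟩ := mem_edgeImage.mp (((O ⟨_, h⟩).mem_iff q).mpr (Or.inl hq))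
    rcases key h j hj i hi hq with h' | h'
    · exact h'.1
    · exact absurd (hmax j hj) (not_le.mpr h'.2)
  · rintro ⟨hi, hlead⟩
    refine ⟨hi, fun j hj => ?_⟩
    by_cases h : F.edgeImage U ∈ (G.contract F).edges
    · rcases key h i hi j hj (hlead h) with h' | h'
      · exact h'.2.le
      · exact h'.2.le
    · have hUF : U ∈ F.edges := by
        by_contra hc
        exact h ((edgeImage_mem_contract_iff hF hU).mpr hc)
      have : Quotient.mk F.components j = Quotient.mk F.components i :=
        Quotient.sound (Relation.EqvGen.rel _ _ ⟨U, hUF, hj, hi⟩)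
      exact (hx.1 j i (congrArg (Quotient.mk O.identified) this)).le

/-- The inequalities of the cone of `O`, in terms of maximal elements of hyperedges. -/
theorem weak_iff_leading_subset (O : (G.contract F).Orientation) (hF : F ∈ G.flats)
    (y : V → ℝ) :
    ((∀ a b, vertexClass O a = vertexClass O b → y a = y b) ∧
      ∀ a b, O.Arrow (vertexClass O a) (vertexClass O b) → y a ≥ y b) ↔
    ∀ U ∈ G.edges, leading O U ⊆ argmaxOn y U := by
  constructor
  · rintro ⟨h1, h2⟩ U hU i hi
    refine ⟨hi.1, fun j hj => ?_⟩
    by_cases h : F.edgeImage U ∈ (G.contract F).edges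
    · rcases ((O ⟨_, h⟩).mem_iff _).mp (mem_edgeImage.mpr ⟨j, hj, rfl⟩) with hj' | hj'
      · exact (h1 _ _ (Quotient.sound (Relation.EqvGen.rel _ _ ⟨_, hj', hi.2 h⟩))).le
      · exact h2 _ _ ⟨_, _, hi.2 h, _, hj', rfl, rfl⟩
    · have hUF : U ∈ F.edges := by
        by_contra hc
        exact h ((edgeImage_mem_contract_iff hF hU).mpr hc)
      have : Quotient.mk F.components j = Quotient.mk F.components i :=
        Quotient.sound (Relation.EqvGen.rel _ _ ⟨U, hUF, hj, hi.1⟩)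
      exact (h1 j i (congrArg (Quotient.mk O.identified) this)).le
  · intro h
    -- For `U ∈ F` the leading set is all of `U`, which forces `y` to be constant on `U`; so `y`
    -- descends to `V/F`.
    have hF' : ∀ a b, F.components a b → y a = y b := by
      refine fun _ _ h_gen => eq_of_eqvGen _ (fun a b hab => ?_) h_gen
      obtain ⟨U, hU, ha, hb⟩ := hab
      have hs := h U (edges_subset_of_mem_flats hF hU)
      rw [leading_of_mem hF O hU] at hs
      exact le_antisymm ((hs hb).2 a ha) ((hs ha).2 b hb)
    let z : Quotient F.components → ℝ := Quotient.lift y hF'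
    have hW : ∀ W : {W // W ∈ (G.contract F).edges}, ∀ p ∈ (O W).head, ∀ q ∈ W.1,
        z q ≤ z p := by
      rintro ⟨W, hW⟩ p hp q hq
      obtain ⟨⟨U, hU, rfl⟩, -⟩ := mem_contract_edges.mp hW
      obtain ⟨i, hi, rfl⟩ := (mem_head_iff O hW p).mp hp
      obtain ⟨j, hj, rfl⟩ := mem_edgeImage.mp hq
      exact (h U hU hi).2 j hj
    have hO : ∀ p q, O.identified p q → z p = z q := by
      refine fun _ _ h_gen => eq_of_eqvGen _ (fun p q hpq => ?_) h_gen
      obtain ⟨W, hp, hq⟩ := hpq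
      exact le_antisymm (hW W q hq p (((O W).mem_iff p).mpr (Or.inl hp)))
        (hW W p hp q (((O W).mem_iff q).mpr (Or.inl hq)))
    refine ⟨fun a b hab => hO _ _ (Quotient.exact hab), ?_⟩
    rintro a b ⟨W, p, hp, q, hq, hap, hbq⟩
    have h1 : y a = z p := hO _ _ (Quotient.exact hap)
    have h2 : y b = z q := hO _ _ (Quotient.exact hbq)
    rw [h1, h2]
    exact hW W p hp q (((O W).mem_iff q).mpr (Or.inr hq))

/-- Every acyclic relation on a finite type admits a strictly decreasing real function. -/
theorem exists_decreasing_of_acyclic {Q : Type*} [Finite Q] (r : Q → Q → Prop)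
    (hr : ∀ p, ¬ Relation.TransGen r p p) : ∃ f : Q → ℝ, ∀ p q, r p q → f q < f p := by
  -- Count the vertices reachable from `p`. Along `p → q` the count drops, since `q` is reachable
  -- from `p` but, by acyclicity, not from itself.
  refine ⟨fun p => ({q | Relation.TransGen r p q} : Set Q).ncard, fun p q hpq => ?_⟩
  refine Nat.cast_lt.mpr (Set.ncard_lt_ncard ?_ (Set.toFinite _))
  refine ⟨fun s hs => Relation.TransGen.head hpq hs, fun h => hr q (h ?_)⟩
  exact Relation.TransGen.single hpq

theorem exists_isStrict [Finite V] (O : (G.contract F).Orientation) (hO : O.IsAcyclic) :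
    ∃ x : V → ℝ, IsStrict O x := by
  have : Finite (Quotient F.components) := Quotient.finite _
  have : Finite (Quotient O.identified) := Quotient.finite _
  obtain ⟨f, hf⟩ := exists_decreasing_of_acyclic O.Arrow hO
  exact ⟨fun v => f (vertexClass O v), fun a b h => congrArg f h, fun a b h => hf _ _ h⟩

/-- The composition of `V` into the level sets of a function. -/
theorem exists_composition_levels [Finite V] (x : V → ℝ) :
    ∃ A : SetComposition V, ∀ U : Finset V, U.Nonempty →
      ((∃ i, U ⊆ A.part i) ↔ ∀ u ∈ U, ∀ v ∈ U, x u = x v) := by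
  classical
  have := Fintype.ofFinite V
  let S := Finset.univ.image x
  let e := S.equivFin
  refine ⟨⟨S.card, fun k => Finset.univ.filter (fun v => x v = (e.symm k).1), ?_, ?_, ?_⟩, ?_⟩
  · intro k
    obtain ⟨v, -, hv⟩ := Finset.mem_image.mp (e.symm k).2
    exact ⟨v, by simp [hv]⟩
  · intro i j hij
    rw [Finset.disjoint_left]
    intro v hi hj
    simp only [Finset.mem_filter, Finset.mem_univ, true_and] at hi hj
    exact hij (e.symm.injective (Subtype.ext (hi.symm.trans hj)))
  · intro v
    exact ⟨e ⟨x v, Finset.mem_image_of_mem x (Finset.mem_univ v)⟩, by simp⟩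
  · rintro U ⟨w, hw⟩
    constructor
    · rintro ⟨i, hi⟩ u hu v hv
      exact (Finset.mem_filter.mp (hi hu)).2.trans (Finset.mem_filter.mp (hi hv)).2.symm
    · intro h
      exact ⟨e ⟨x w, Finset.mem_image_of_mem x (Finset.mem_univ w)⟩,
        fun u hu => by simpa using h u hu w hw⟩

/-- Every `x` is strict for an acyclic orientation of the contraction by the flat of hyperedges on
which `x` is constant. -/
theorem exists_acyclicOrientation_isStrict [Finite V] (G : HGraph V) (x : V → ℝ) :
    ∃ o : G.AcyclicOrientations, IsStrict o.2.1 x := by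
  classical
  obtain ⟨A, hA⟩ := exists_composition_levels x
  let F := G.restrict A
  have hF : F ∈ G.flats := ⟨A, rfl⟩
  have hFx : ∀ U ∈ G.edges, (U ∈ F.edges ↔ ∀ u ∈ U, ∀ v ∈ U, x u = x v) := by
    intro U hU
    rw [← hA U (nonempty_of_mem_edges hU)]
    exact Finset.mem_filter.trans (and_iff_right hU)
  have hcomp : ∀ a b, F.components a b → x a = x b := by
    refine fun _ _ h_gen => eq_of_eqvGen _ (fun a b hab => ?_) h_gen
    obtain ⟨U, hU, ha, hb⟩ := hab
    exact (hFx U (edges_subset_of_mem_flats hF hU)).mp hU a ha b hb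
  let z : Quotient F.components → ℝ := Quotient.lift x hcomp
  let O : (G.contract F).Orientation := fun W =>
    { head := W.1.filter (fun p => ∀ q ∈ W.1, z q ≤ z p)
      tail := W.1.filter (fun p => ¬ ∀ q ∈ W.1, z q ≤ z p)
      head_nonempty := by
        obtain ⟨p, hp, h⟩ := W.1.exists_max_image z (nonempty_of_mem_edges W.2)
        exact ⟨p, Finset.mem_filter.mpr ⟨hp, h⟩⟩
      tail_nonempty := by
        obtain ⟨W, hW⟩ := W
        obtain ⟨⟨U, hU, rfl⟩, -⟩ := mem_contract_edges.mp hW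
        -- A surviving hyperedge is outside `F`, so `x` takes two values on it and the smaller one
        -- lands in the tail.
        have h := mt (hFx U hU).mpr ((edgeImage_mem_contract_iff hF hU).mp hW)
        push Not at h
        obtain ⟨u, hu, v, hv, huv⟩ := h
        have hu' : Quotient.mk F.components u ∈ F.edgeImage U := mem_edgeImage.mpr ⟨u, hu, rfl⟩
        have hv' : Quotient.mk F.components v ∈ F.edgeImage U := mem_edgeImage.mpr ⟨v, hv, rfl⟩
        rcases lt_or_gt_of_ne huv with h | h
        · exact ⟨_, Finset.mem_filter.mpr ⟨hu', fun hc => absurd (hc _ hv') (not_le.mpr h)⟩⟩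
        · exact ⟨_, Finset.mem_filter.mpr ⟨hv', fun hc => absurd (hc _ hu') (not_le.mpr h)⟩⟩
      disjoint := Finset.disjoint_filter_filter_not _ _ _
      mem_iff := fun v => by simp only [Finset.mem_filter]; tauto }
  have hident : ∀ p q, O.identified p q → z p = z q := by
    refine fun _ _ h_gen => eq_of_eqvGen _ (fun p q hpq => ?_) h_gen
    obtain ⟨W, hp, hq⟩ := hpq
    have hp := Finset.mem_filter.mp hp
    have hq := Finset.mem_filter.mp hq
    exact le_antisymm (hq.2 _ hp.1) (hp.2 _ hq.1)
  let t : Quotient O.identified → ℝ := Quotient.lift z hident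
  have harrow : ∀ p q, O.Arrow p q → t q < t p := by
    rintro _ _ ⟨W, a, ha, b, hb, rfl, rfl⟩
    have ha := Finset.mem_filter.mp ha
    have hb := Finset.mem_filter.mp hb
    obtain ⟨c, hc, hbc⟩ : ∃ c ∈ W.1, z b < z c := by
      simpa only [not_forall, not_le, exists_prop] using hb.2
    exact lt_of_lt_of_le hbc (ha.2 c hc)
  -- The values of `t` strictly decrease along directed paths, so none can close up.
  have hacyc : O.IsAcyclic := by
    have : ∀ p q, Relation.TransGen O.Arrow p q → t q < t p := by
      intro p q h
      induction h with
      | single h => exact harrow _ _ h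
      | tail _ h ih => exact (harrow _ _ h).trans ih
    exact fun p hp => lt_irrefl _ (this p p hp)
  exact ⟨⟨⟨F, hF⟩, O, hacyc⟩, fun a b h => congrArg t h, fun a b h => harrow _ _ h⟩

end Combinatorics

/-! ### Maximal faces of the Minkowski sum -/

section Polytope

variable {n : ℕ} {G : HGraph (Fin n)}

/-- The coordinates `x_i = x (e_i)` of a linear functional. -/
def coords (x : StrongDual ℝ (Fin n → ℝ)) (i : Fin n) : ℝ := x (Pi.single i 1)

theorem exists_coords_eq (x : Fin n → ℝ) : ∃ y : StrongDual ℝ (Fin n → ℝ), coords y = x := by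
  refine ⟨∑ i, x i • ContinuousLinearMap.proj i, funext fun j => ?_⟩
  simp [coords, Pi.single_apply]

/-- The simplex `Δ_U`. -/
abbrev simplex (U : Finset (Fin n)) : Set (Fin n → ℝ) :=
  convexHull ℝ ((fun i : Fin n => (Pi.single i 1 : Fin n → ℝ)) '' (U : Set (Fin n)))

theorem single_mem_simplex {U : Finset (Fin n)} {i : Fin n} (hi : i ∈ U) :
    (Pi.single i 1 : Fin n → ℝ) ∈ simplex U :=
  subset_convexHull ℝ _ ⟨i, hi, rfl⟩

theorem mem_polytope {p : Fin n → ℝ} :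
    p ∈ G.polytope ↔
      ∃ s : Finset (Fin n) → Fin n → ℝ, (∀ U ∈ G.edges, s U ∈ simplex U) ∧
        ∑ U ∈ G.edges, s U = p := by
  rw [polytope, Set.mem_finsetSum]
  constructor
  · rintro ⟨s, hs, rfl⟩
    exact ⟨s, fun U hU => hs hU, rfl⟩
  · rintro ⟨s, hs, rfl⟩
    exact ⟨s, fun {U} hU => hs U hU, rfl⟩

theorem apply_le_of_mem_simplex (x : StrongDual ℝ (Fin n → ℝ)) {U : Finset (Fin n)} {i : Fin n}
    (hi : i ∈ argmaxOn (coords x) U) {p : Fin n → ℝ} (hp : p ∈ simplex U) : x p ≤ coords x i := by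
  have hc : Convex ℝ {q : Fin n → ℝ | x q ≤ coords x i} :=
    convex_halfSpace_le x.toLinearMap.isLinear _
  refine convexHull_min ?_ hc hp
  rintro _ ⟨j, hj, rfl⟩
  exact hi.2 j hj

/-- A maximizer of `x` on a simplex maximizes `y` too if all maximizing vertices do. -/
theorem apply_eq_of_mem_simplex (x y : StrongDual ℝ (Fin n → ℝ)) {U : Finset (Fin n)} {i : Fin n}
    (h : argmaxOn (coords x) U ⊆ argmaxOn (coords y) U) (hi : i ∈ argmaxOn (coords x) U)
    {p : Fin n → ℝ} (hp : p ∈ simplex U) (hpx : coords x i ≤ x p) : coords y i ≤ y p := by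
  -- For `K` large, `K • x - y` is also maximal at `i` on the simplex; since `x p` is maximal, this
  -- bounds `y p` from below. Vertices tied with `i` for `x` are tied for `y` and need only `K = 0`;
  -- summing the individual constants serves all vertices at once.
  obtain ⟨K, hK⟩ : ∃ K : ℝ, ∀ j ∈ U, coords y i - coords y j ≤ K * (coords x i - coords x j) := by
    have hj : ∀ j ∈ U, ∃ K : ℝ, 0 ≤ K ∧
        coords y i - coords y j ≤ K * (coords x i - coords x j) := by
      intro j hj
      rcases (hi.2 j hj).lt_or_eq with hlt | heq
      · have hpos : 0 < coords x i - coords x j := sub_pos.mpr hlt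
        have hy : 0 ≤ coords y i - coords y j := sub_nonneg.mpr ((h hi).2 j hj)
        exact ⟨(coords y i - coords y j) / (coords x i - coords x j), by positivity,
          (div_mul_cancel₀ _ hpos.ne').ge⟩
      · refine ⟨0, le_rfl, ?_⟩
        have hjm : j ∈ argmaxOn (coords x) U := ⟨hj, fun k hk => heq ▸ hi.2 k hk⟩
        have := (h hjm).2 i hi.1
        linarith
    choose! k hk0 hk using hj
    refine ⟨∑ j ∈ U, k j, fun j hj => (hk j hj).trans ?_⟩
    exact mul_le_mul_of_nonneg_right (Finset.single_le_sum hk0 hj)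
      (sub_nonneg.mpr (hi.2 j hj))
  have hc : Convex ℝ {q : Fin n → ℝ | (K • x - y) q ≤ K * coords x i - coords y i} :=
    convex_halfSpace_le (K • x - y).toLinearMap.isLinear _
  have hmem : (K • x - y) p ≤ K * coords x i - coords y i := by
    refine convexHull_min ?_ hc hp
    rintro _ ⟨j, hj, rfl⟩
    have hKj := hK j hj
    have : (K • x - y) (Pi.single j 1) = K * coords x j - coords y j := by simp [coords]
    simp only [Set.mem_ofPred_eq, this]
    linarith
  have hpx' : x p = coords x i := le_antisymm (apply_le_of_mem_simplex x hi hp) hpx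
  have : (K • x - y) p = K * coords x i - y p := by simp [hpx']
  linarith

/-- The set of maximizers of a linear functional over `P_G`. -/
def maxFace (G : HGraph (Fin n)) (x : StrongDual ℝ (Fin n → ℝ)) : Set (Fin n → ℝ) :=
  {p ∈ G.polytope | ∀ q ∈ G.polytope, x q ≤ x p}

/-- A choice, for each hyperedge, of a vertex of its simplex maximizing `x`. -/
def IsVertexChoice (G : HGraph (Fin n)) (x : Fin n → ℝ)
    (v : Finset (Fin n) → Fin n → ℝ) : Prop :=
  ∀ U ∈ G.edges, ∃ i ∈ argmaxOn x U, v U = Pi.single i 1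

theorem exists_isVertexChoice (G : HGraph (Fin n)) (x : Fin n → ℝ) :
    ∃ v, G.IsVertexChoice x v := by
  have : ∀ U ∈ G.edges, ∃ p : Fin n → ℝ, ∃ i ∈ argmaxOn x U, p = Pi.single i 1 := by
    intro U hU
    obtain ⟨i, hi⟩ := argmaxOn_nonempty x (nonempty_of_mem_edges hU)
    exact ⟨_, i, hi, rfl⟩
  choose! v hv using this
  exact ⟨v, hv⟩

theorem IsVertexChoice.mem_simplex {x : Fin n → ℝ} {v : Finset (Fin n) → Fin n → ℝ}
    (hv : G.IsVertexChoice x v) {U : Finset (Fin n)} (hU : U ∈ G.edges) : v U ∈ simplex U := by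
  obtain ⟨i, hi, h⟩ := hv U hU
  exact h ▸ single_mem_simplex hi.1

theorem IsVertexChoice.apply_le {x : StrongDual ℝ (Fin n → ℝ)} {v : Finset (Fin n) → Fin n → ℝ}
    (hv : G.IsVertexChoice (coords x) v) {U : Finset (Fin n)} (hU : U ∈ G.edges)
    {p : Fin n → ℝ} (hp : p ∈ simplex U) : x p ≤ x (v U) := by
  obtain ⟨i, hi, h⟩ := hv U hU
  exact h ▸ apply_le_of_mem_simplex x hi hp

theorem IsVertexChoice.sum_mem_maxFace {x : StrongDual ℝ (Fin n → ℝ)}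
    {v : Finset (Fin n) → Fin n → ℝ} (hv : G.IsVertexChoice (coords x) v) :
    ∑ U ∈ G.edges, v U ∈ G.maxFace x := by
  refine ⟨mem_polytope.mpr ⟨v, fun U hU => hv.mem_simplex hU, rfl⟩, fun q hq => ?_⟩
  obtain ⟨s, hs, rfl⟩ := mem_polytope.mp hq
  rw [map_sum, map_sum]
  exact Finset.sum_le_sum fun U hU => hv.apply_le hU (hs U hU)

theorem maxFace_nonempty (G : HGraph (Fin n)) (x : StrongDual ℝ (Fin n → ℝ)) :
    (G.maxFace x).Nonempty := by
  obtain ⟨v, hv⟩ := G.exists_isVertexChoice (coords x)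
  exact ⟨_, hv.sum_mem_maxFace⟩

theorem maxFace_mem_polytopeFaces (G : HGraph (Fin n)) (x : StrongDual ℝ (Fin n → ℝ)) :
    G.maxFace x ∈ polytopeFaces G.polytope :=
  ⟨G.maxFace_nonempty x, fun _ => ⟨x, rfl⟩⟩

/-- Forward, changing the chosen vertex in a single simplex compares `y` at two vertices of that
simplex. Backward, a maximizer of `x` has `x`-maximal summands, and each of these is `y`-maximal. -/
theorem maxFace_subset_iff (x y : StrongDual ℝ (Fin n → ℝ)) :
    G.maxFace x ⊆ G.maxFace y ↔
      ∀ U ∈ G.edges, argmaxOn (coords x) U ⊆ argmaxOn (coords y) U := by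
  obtain ⟨v, hv⟩ := G.exists_isVertexChoice (coords x)
  constructor
  · intro h U hU i hi
    refine ⟨hi.1, fun j hj => ?_⟩
    have hvi : G.IsVertexChoice (coords x) (Function.update v U (Pi.single i 1)) := by
      intro W hW
      rcases eq_or_ne W U with rfl | hne
      · exact ⟨i, hi, Function.update_self ..⟩
      · rw [Function.update_of_ne hne]
        exact hv W hW
    have hq : ∑ W ∈ G.edges, Function.update v U (Pi.single j 1) W ∈ G.polytope := by
      refine mem_polytope.mpr ⟨_, fun W hW => ?_, rfl⟩
      rcases eq_or_ne W U with rfl | hne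
      · rw [Function.update_self]
        exact single_mem_simplex hj
      · rw [Function.update_of_ne hne]
        exact hv.mem_simplex hW
    have hle := (h hvi.sum_mem_maxFace).2 _ hq
    rw [Finset.sum_update_of_mem hU, Finset.sum_update_of_mem hU, map_add, map_add] at hle
    exact le_of_add_le_add_right hle
  · rintro h p ⟨hp, hmax⟩
    refine ⟨hp, fun q hq => ?_⟩
    have hvy : G.IsVertexChoice (coords y) v := by
      intro U hU
      obtain ⟨i, hi, hvU⟩ := hv U hU
      exact ⟨i, h U hU hi, hvU⟩
    refine (hvy.sum_mem_maxFace.2 q hq).trans ?_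
    obtain ⟨s, hs, rfl⟩ := mem_polytope.mp hp
    have hle := hmax _ hv.sum_mem_maxFace.1
    rw [map_sum, map_sum] at hle ⊢
    have hterm : ∀ U ∈ G.edges, x (s U) ≤ x (v U) := fun U hU => hv.apply_le hU (hs U hU)
    -- Equal sums with termwise inequalities force termwise equality: each `s U` maximizes `x` on
    -- its simplex.
    have heq := (Finset.sum_eq_sum_iff_of_le hterm).mp (le_antisymm (Finset.sum_le_sum hterm) hle)
    refine Finset.sum_le_sum fun U hU => ?_
    obtain ⟨i, hi, hvU⟩ := hv U hU
    have hx := heq U hU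
    rw [hvU] at hx ⊢
    exact apply_eq_of_mem_simplex x y (h U hU) hi (hs U hU) hx.ge

/-! ### Matching orientations with faces -/

theorem mem_orientationCone_iff {F : HGraph (Fin n)} (hF : F ∈ G.flats)
    (O : (G.contract F).Orientation) (y : StrongDual ℝ (Fin n → ℝ)) :
    y ∈ orientationCone O ↔ ∀ U ∈ G.edges, leading O U ⊆ argmaxOn (coords y) U :=
  weak_iff_leading_subset O hF (coords y)

theorem exists_functional_isStrict (o : G.AcyclicOrientations) :
    ∃ x : StrongDual ℝ (Fin n → ℝ), IsStrict o.2.1 (coords x) := by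
  obtain ⟨x, hx⟩ := exists_isStrict o.2.1 o.2.2
  obtain ⟨y, rfl⟩ := exists_coords_eq x
  exact ⟨y, hx⟩

/-- A functional strict for the orientation `o`, i.e. in the relative interior of its cone. -/
noncomputable def strictFunctional (o : G.AcyclicOrientations) : StrongDual ℝ (Fin n → ℝ) :=
  (exists_functional_isStrict o).choose

theorem argmaxOn_strictFunctional (o : G.AcyclicOrientations) {U : Finset (Fin n)}
    (hU : U ∈ G.edges) : argmaxOn (coords (strictFunctional o)) U = leading o.2.1 U :=
  (exists_functional_isStrict o).choose_spec.argmaxOn_eq o.1.2 hU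

/-- The face of `P_G` maximizing a functional strict for `o`. -/
noncomputable def orientationFace (o : G.AcyclicOrientations) :
    {f : Set (Fin n → ℝ) // f ∈ polytopeFaces G.polytope} :=
  ⟨G.maxFace (strictFunctional o), G.maxFace_mem_polytopeFaces _⟩

theorem normalCone_orientationFace (o : G.AcyclicOrientations) :
    normalCone G.polytope (orientationFace o).1 = orientationCone o.2.1 := by
  ext y
  rw [mem_orientationCone_iff o.1.2]
  refine (maxFace_subset_iff (strictFunctional o) y).trans (forall₂_congr fun U hU => ?_)
  rw [argmaxOn_strictFunctional o hU]

theorem orientationFace_bijective :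
    Function.Bijective (orientationFace : G.AcyclicOrientations → _) := by
  constructor
  · intro o o' h
    have hf : G.maxFace (strictFunctional o) = G.maxFace (strictFunctional o') :=
      congrArg Subtype.val h
    refine AcyclicOrientations.eq_of_leading_eq o o' fun U hU => ?_
    rw [← argmaxOn_strictFunctional o hU, ← argmaxOn_strictFunctional o' hU]
    exact ((maxFace_subset_iff _ _).mp hf.subset U hU).antisymm
      ((maxFace_subset_iff _ _).mp hf.superset U hU)
  · rintro ⟨f, hne, hf⟩
    obtain ⟨x, rfl⟩ := hf hne
    -- Both `x` and the chosen `strictFunctional o` are strict for `o`, so they have the same argmax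
    -- sets and hence the same face.
    obtain ⟨o, ho⟩ := exists_acyclicOrientation_isStrict G (coords x)
    have heq : ∀ U ∈ G.edges,
        argmaxOn (coords (strictFunctional o)) U = argmaxOn (coords x) U := fun U hU =>
      (argmaxOn_strictFunctional o hU).trans (ho.argmaxOn_eq o.1.2 hU).symm
    refine ⟨o, Subtype.ext (Set.Subset.antisymm ?_ ?_)⟩
    · exact (maxFace_subset_iff _ x).mpr fun U hU => (heq U hU).subset
    · exact (maxFace_subset_iff x _).mpr fun U hU => (heq U hU).superset

end Polytope

end HGraph

theorem mainTheorem1 (n : ℕ) (G : HGraph (Fin n)) :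
    normalFan G.polytope =
        Set.range (fun o : G.AcyclicOrientations => HGraph.orientationCone o.2.1) ∧
      ∃ φ : G.AcyclicOrientations ≃ {f : Set (Fin n → ℝ) // f ∈ polytopeFaces G.polytope},
        ∀ o : G.AcyclicOrientations,
          normalCone G.polytope (φ o).1 = HGraph.orientationCone o.2.1 := by
  refine ⟨Set.ext fun C => ?_, Equiv.ofBijective _ HGraph.orientationFace_bijective,
    HGraph.normalCone_orientationFace⟩
  constructor
  · rintro ⟨f, hf, rfl⟩
    obtain ⟨o, ho⟩ := HGraph.orientationFace_bijective.2 ⟨f, hf⟩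
    refine ⟨o, ?_⟩
    change HGraph.orientationCone o.2.1 = _
    rw [← HGraph.normalCone_orientationFace, ho]
  · rintro ⟨o, rfl⟩
    exact ⟨_, (HGraph.orientationFace o).2, (HGraph.normalCone_orientationFace o).symm⟩
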